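/- Convex layers. For a finite set $S\subset\mathbb R^2$, take the convex hull of $S$, remove from $S$ all points lying on the boundary of this hull, and repeat with the remaining points until no point is left. If this takes exactly $t$ rounds, we say that $S$ has $t$ nested convex hulls (if all points of a nonempty $S$ are collinear, then $t=1$; for $S=\emptyset$, $t=0$). Angle-monotone graphs. A geometric graph spanning $S$ is a simple graph with vertex set $S$ whose edges are drawn as straight-line segments. A path $p_0,p_1,\dots,p_k$ in it is angle-monotone of width $90^\circ$ if there is a closed wedge of angle $90^\circ$ that contains all the edge vectors $p_{i+1}-p_i$. The graph is angle-monotone of width $90^\circ$ if every two of its vertices are connected by an angle-monotone path of width $90^\circ$. Statement. There is an absolute constant $C>0$ such that for every $t$ and every finite set $S$ of $n$ points in the plane with $t$ nested convex hulls there is an angle-monotone graph of width $90^\circ$ spanning $S$ with at most $C\,t^2\,n\log n$ edges (where for $n=0$ the bound is read as $0$). -/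

import Mathlib

/-- The Euclidean plane. -/
abbrev Plane : Type := EuclideanSpace ℝ (Fin 2)

/-- The directions of the closed wedge of angle `γ` (with `0 ≤ γ ≤ 2π`) whose bisector is spanned
by `u`: the vectors making an (unoriented) angle at most `γ / 2` with `u`. It is only used for
`u ≠ 0`, and only nonzero vectors (edges between distinct points) are tested for membership. -/
noncomputable def wedge (u : Plane) (γ : ℝ) : Set Plane :=
  {v | InnerProductGeometry.angle u v ≤ γ / 2}

/-- A geometric graph on a finite point set `S` is a simple graph with vertex set `S`, its edges
being drawn as straight segments. A path of it is angle-monotone of width `γ` if a single wedge of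
angle `γ` contains the vectors of all its edges, directed along the path. -/
def IsAngleMonotonePath {S : Finset Plane} {G : SimpleGraph S} {a b : S}
    (γ : ℝ) (p : G.Walk a b) : Prop :=
  p.IsPath ∧ ∃ u : Plane, u ≠ 0 ∧
    ∀ d ∈ p.darts, (d.snd : Plane) - (d.fst : Plane) ∈ wedge u γ

/-- A geometric graph is angle-monotone of width `γ` if any two vertices are connected by an
angle-monotone path of width `γ`. -/
def IsAngleMonotoneGraph {S : Finset Plane} (γ : ℝ) (G : SimpleGraph S) : Prop :=
  ∀ a b : S, ∃ p : G.Walk a b, IsAngleMonotonePath γ p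

open Classical in
/-- Removes from `S` the points on the boundary of its convex hull. (A point of `S` is in the hull,
so it is on the boundary exactly when it is not in the interior.) -/
noncomputable def peel (S : Finset Plane) : Finset Plane :=
  S.filter fun p => p ∉ frontier (convexHull ℝ (S : Set Plane))

/-- `S` has `t` nested convex hulls: repeatedly taking the convex hull of the remaining points and
removing the points on its boundary exhausts `S` after exactly `t` rounds. -/
def HasNestedConvexHulls (S : Finset Plane) (t : ℕ) : Prop :=
  peel^[t] S = ∅ ∧ ∀ i < t, (peel^[i] S).Nonempty

/-! Give each point of a convex layer an outer normal of that layer, written as a sign times a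
direction with angle in `[0, π]`. The layer and the sign form one of `2t` colours. If two points of
one colour have labels in `[β - π/2, β]`, they are comparable in the dominance order of the frame of
angle `β`: otherwise their difference would be strictly negative, or strictly positive, against both
normals, contradicting one of them (`frameLE_or_frameLE_of_normals`). So such labels give one chain
per colour, and linking every point to its successor in each chain yields monotone walks to all
comparable chain points at linear cost per colour (`SimpleGraph.exists_graph_of_chains`).

Any two points are comparable in the frame `β` or in `β + π/2`. If `β` separates their labels, the
lower labels form chains for the first frame and the upper ones for the second, so one endpoint lies
on a usable chain in either case. Median splits of the labels then reach all pairs in logarithmic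
depth. This costs `O(t n log n)` edges, better than required in `t`. -/

/-! ### Successor graphs of chains in a partial order -/

/-- A nonempty finite set on which a transitive relation is total has a least element. -/
theorem Finset.exists_least_of_total {V : Type*} (r : V → V → Prop) (hrefl : ∀ x, r x x)
    (htrans : ∀ x y z, r x y → r y z → r x z) (T : Finset V) (hne : T.Nonempty)
    (htot : ∀ x ∈ T, ∀ y ∈ T, r x y ∨ r y x) : ∃ w ∈ T, ∀ z ∈ T, r w z := by
  classical
  induction hne using Finset.Nonempty.cons_induction with
  | singleton a => exact ⟨a, by simp, by simp [hrefl]⟩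
  | cons a s ha hs ih =>
    obtain ⟨w, hw, hmin⟩ := ih fun x hx y hy =>
      htot x (Finset.mem_cons_of_mem hx) y (Finset.mem_cons_of_mem hy)
    rcases htot a (Finset.mem_cons_self a s) w (Finset.mem_cons_of_mem hw) with h | h
    · refine ⟨a, Finset.mem_cons_self a s, fun z hz => ?_⟩
      rcases Finset.mem_cons.1 hz with rfl | hz
      · exact hrefl _
      · exact htrans _ _ _ h (hmin z hz)
    · refine ⟨w, Finset.mem_cons_of_mem hw, fun z hz => ?_⟩
      rcases Finset.mem_cons.1 hz with rfl | hz
      · exact h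
      · exact hmin z hz

/-- If each colour class of `I` is a chain for a partial order `r`, then a graph with at most
`|X|` edges per colour contains an `r`-increasing walk between any `x ∈ X` and `z ∈ I` with
`r x z`: join each point of `X` to its successor in each chain. -/
theorem SimpleGraph.exists_graph_of_chains {V κ : Type*} [Fintype κ] (r : V → V → Prop)
    (hrefl : ∀ x, r x x) (htrans : ∀ x y z, r x y → r y z → r x z)
    (hanti : ∀ x y, r x y → r y x → x = y) (col : V → κ) (X I : Finset V) (hI : I ⊆ X)
    (hchain : ∀ x ∈ I, ∀ y ∈ I, col x = col y → r x y ∨ r y x) :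
    ∃ G : SimpleGraph V, G.edgeSet.ncard ≤ X.card * Fintype.card κ ∧
      ∀ x ∈ X, ∀ z ∈ I, r x z → ∃ p : G.Walk x z, ∀ d ∈ p.darts, r d.fst d.snd := by
  classical
  have hup : ∀ (c : κ) (x : V), ∃ w, (∃ z ∈ I, col z = c ∧ r x z ∧ z ≠ x) →
      (w ∈ I ∧ r x w ∧ w ≠ x ∧ ∀ z ∈ I, col z = c → r x z → z ≠ x → r w z) := by
    intro c x
    by_cases h : ∃ z ∈ I, col z = c ∧ r x z ∧ z ≠ x
    · obtain ⟨w, hw, hmin⟩ := Finset.exists_least_of_total r hrefl htrans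
        (I.filter fun z => col z = c ∧ r x z ∧ z ≠ x)
        (by obtain ⟨z, hz⟩ := h; exact ⟨z, Finset.mem_filter.2 hz⟩)
        (fun a ha b hb => by
          rw [Finset.mem_filter] at ha hb
          exact hchain a ha.1 b hb.1 (ha.2.1.trans hb.2.1.symm))
      rw [Finset.mem_filter] at hw
      exact ⟨w, fun _ => ⟨hw.1, hw.2.2.1, hw.2.2.2, fun z hz h1 h2 h3 =>
        hmin z (Finset.mem_filter.2 ⟨hz, h1, h2, h3⟩)⟩⟩
    · exact ⟨x, fun h' => absurd h' h⟩
  choose up hup using hup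
  set E : Finset (Sym2 V) := (X ×ˢ (Finset.univ : Finset κ)).image fun a => s(a.1, up a.2 a.1)
    with hE
  have hsub : (SimpleGraph.fromEdgeSet (E : Set (Sym2 V))).edgeSet ⊆ (E : Set (Sym2 V)) := by
    rw [SimpleGraph.edgeSet_fromEdgeSet]
    exact Set.sdiff_subset
  refine ⟨SimpleGraph.fromEdgeSet (E : Set (Sym2 V)), ?_, ?_⟩
  · calc _ ≤ (E : Set (Sym2 V)).ncard := Set.ncard_le_ncard hsub E.finite_toSet
      _ = E.card := Set.ncard_coe_finset E
      _ ≤ (X ×ˢ (Finset.univ : Finset κ)).card := Finset.card_image_le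
      _ = _ := by rw [Finset.card_product, Finset.card_univ]
  · intro x hx z hz hxz
    -- Move to the successor of `x` in the chain of `z`: it is still below `z`, and fewer points of
    -- `I` lie strictly above it.
    induction hm : (I.filter fun y => r x y ∧ y ≠ x).card using Nat.strong_induction_on
      generalizing x with
    | _ m ih =>
    by_cases hne : z = x
    · subst hne
      exact ⟨SimpleGraph.Walk.nil, by simp⟩
    · obtain ⟨hwI, hxw, hwx, hmin⟩ := hup (col z) x ⟨z, hz, rfl, hxz, hne⟩
      have hwz := hmin z hz rfl hxz hne
      obtain ⟨p, hp⟩ := ih _ (by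
        rw [← hm]
        apply Finset.card_lt_card
        rw [Finset.ssubset_iff_of_subset]
        · exact ⟨up (col z) x, Finset.mem_filter.2 ⟨hwI, hxw, hwx⟩, by simp⟩
        · intro y hy
          rw [Finset.mem_filter] at hy ⊢
          refine ⟨hy.1, htrans _ _ _ hxw hy.2.1, ?_⟩
          rintro rfl
          exact hwx (hanti _ _ hy.2.1 hxw)) _ (hI hwI) hwz rfl
      have hadj : (SimpleGraph.fromEdgeSet (E : Set (Sym2 V))).Adj x (up (col z) x) := by
        rw [SimpleGraph.fromEdgeSet_adj]
        refine ⟨?_, hwx.symm⟩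
        rw [Finset.mem_coe, hE, Finset.mem_image]
        exact ⟨(x, col z), by simp [hx], rfl⟩
      refine ⟨SimpleGraph.Walk.cons hadj p, fun d hd => ?_⟩
      rw [SimpleGraph.Walk.darts_cons, List.mem_cons] at hd
      rcases hd with rfl | hd
      · exact hxw
      · exact hp d hd

/-! ### Dominance orders of rotated frames -/

/-- The component of `v` in the direction of angle `β`. -/
noncomputable def component (β : ℝ) (v : Plane) : ℝ := Real.cos β * v 0 + Real.sin β * v 1

/-- The dominance order of the orthonormal frame whose first axis has angle `β`. -/
def FrameLE (β : ℝ) (p q : Plane) : Prop :=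
  0 ≤ component β (q - p) ∧ 0 ≤ component (β + Real.pi / 2) (q - p)

theorem component_add_pi_div_two (β : ℝ) (v : Plane) :
    component (β + Real.pi / 2) v = -Real.sin β * v 0 + Real.cos β * v 1 := by
  simp [component, Real.cos_add_pi_div_two, Real.sin_add_pi_div_two]

theorem component_add_pi (β : ℝ) (v : Plane) : component (β + Real.pi) v = -component β v := by
  simp [component]; ring

theorem component_sub_swap (β : ℝ) (p q : Plane) :
    component β (p - q) = -component β (q - p) := by
  simp [component]; ring

theorem component_sub_add_sub (β : ℝ) (p q s : Plane) :
    component β (s - p) = component β (q - p) + component β (s - q) := by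
  simp [component]; ring

theorem FrameLE.refl (β : ℝ) (p : Plane) : FrameLE β p p := by
  simp [FrameLE, component]

theorem FrameLE.trans {β : ℝ} {p q s : Plane} (h : FrameLE β p q) (h' : FrameLE β q s) :
    FrameLE β p s := by
  unfold FrameLE at *
  rw [component_sub_add_sub β p q s, component_sub_add_sub (β + Real.pi / 2) p q s]
  exact ⟨add_nonneg h.1 h'.1, add_nonneg h.2 h'.2⟩

theorem FrameLE.antisymm {β : ℝ} {p q : Plane} (h : FrameLE β p q) (h' : FrameLE β q p) :
    p = q := by
  unfold FrameLE at *
  rw [component_sub_swap β p q, component_sub_swap _ p q] at h'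
  have h1 : component β (q - p) = 0 := by linarith
  have h2 : component (β + Real.pi / 2) (q - p) = 0 := by linarith
  rw [component_add_pi_div_two] at h2
  unfold component at h1
  have hsc := Real.sin_sq_add_cos_sq β
  have e0 : (q - p) 0 = 0 := by
    linear_combination Real.cos β * h1 - Real.sin β * h2 - (q - p) 0 * hsc
  have e1 : (q - p) 1 = 0 := by
    linear_combination Real.sin β * h1 + Real.cos β * h2 - (q - p) 1 * hsc
  symm
  rw [← sub_eq_zero]
  ext i
  fin_cases i
  · exact e0
  · exact e1

theorem frameLE_add_pi {β : ℝ} {p q : Plane} : FrameLE (β + Real.pi) p q ↔ FrameLE β q p := by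
  unfold FrameLE
  rw [add_right_comm, component_add_pi, component_add_pi, ← component_sub_swap,
    ← component_sub_swap]

/-- Two points are comparable in a frame or in the frame turned by a right angle. -/
theorem frameLE_total (β : ℝ) (p q : Plane) :
    (FrameLE β p q ∨ FrameLE β q p) ∨
      (FrameLE (β + Real.pi / 2) p q ∨ FrameLE (β + Real.pi / 2) q p) := by
  unfold FrameLE
  have hpi : β + Real.pi / 2 + Real.pi / 2 = β + Real.pi := by ring
  rw [hpi, component_add_pi, component_add_pi, component_sub_swap β p q,
    component_sub_swap (β + Real.pi / 2) p q]
  rcases le_total 0 (component β (q - p)) with h1 | h1 <;>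
    rcases le_total 0 (component (β + Real.pi / 2) (q - p)) with h2 | h2
  · exact Or.inl (Or.inl ⟨h1, h2⟩)
  · exact Or.inr (Or.inr ⟨by linarith, by linarith⟩)
  · exact Or.inr (Or.inl ⟨by linarith, by linarith⟩)
  · exact Or.inl (Or.inr ⟨by linarith, by linarith⟩)

/-- Expands the unit vector of angle `φ` in the frame `β`. For `φ` in `[β - π/2, β]` the first
coefficient is nonnegative and the second nonpositive. -/
theorem component_eq_of_frame (φ β : ℝ) (v : Plane) :
    component φ v = Real.cos (β - φ) * component β v
      - Real.sin (β - φ) * component (β + Real.pi / 2) v := by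
  rw [component_add_pi_div_two, Real.cos_sub, Real.sin_sub]
  unfold component
  linear_combination (-Real.cos φ * v 0 - Real.sin φ * v 1) * Real.sin_sq_add_cos_sq β

/-- A vector with negative first and positive second frame coordinate has negative component in
every direction of the closed quadrant spanned by the first axis and the reversed second one. -/
theorem component_neg_of_frame {φ β : ℝ} (hφ : φ ∈ Set.Icc (β - Real.pi / 2) β) {v : Plane}
    (hx : component β v < 0) (hy : 0 < component (β + Real.pi / 2) v) : component φ v < 0 := by
  obtain ⟨h1, h2⟩ := hφ
  rw [component_eq_of_frame φ β]
  have hc : 0 ≤ Real.cos (β - φ) := Real.cos_nonneg_of_mem_Icc ⟨by linarith, by linarith⟩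
  have hs : 0 ≤ Real.sin (β - φ) := Real.sin_nonneg_of_nonneg_of_le_pi (by linarith) (by
    linarith [Real.pi_pos])
  have hsc := Real.sin_sq_add_cos_sq (β - φ)
  have h3 := mul_nonneg hs hy.le
  have h4 := mul_nonneg hc (neg_pos.2 hx).le
  -- Strictness holds because the cosine and the sine do not vanish together.
  rcases hc.eq_or_lt with hc0 | hc0
  · have : 0 < Real.sin (β - φ) := by
      rcases hs.eq_or_lt with hs0 | hs0
      · rw [← hc0, ← hs0] at hsc; norm_num at hsc
      · exact hs0
    have := mul_pos this hy
    linarith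
  · have := mul_pos hc0 (neg_pos.2 hx)
    linarith

/-- Two points of a set that have outer normals in a common quadrant are comparable in the frame
of that quadrant. -/
theorem frameLE_or_frameLE_of_normals {φ ψ β σ : ℝ} (hσ : σ = 1 ∨ σ = -1)
    (hφ : φ ∈ Set.Icc (β - Real.pi / 2) β) (hψ : ψ ∈ Set.Icc (β - Real.pi / 2) β) {p q : Plane}
    (hp : σ * component φ (q - p) ≤ 0) (hq : σ * component ψ (p - q) ≤ 0) :
    FrameLE β p q ∨ FrameLE β q p := by
  have key : ∀ v : Plane, component β v < 0 → 0 < component (β + Real.pi / 2) v →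
      component φ v < 0 ∧ component ψ v < 0 :=
    fun v h1 h2 => ⟨component_neg_of_frame hφ h1 h2, component_neg_of_frame hψ h1 h2⟩
  have k1 := key (q - p)
  have k2 := key (p - q)
  unfold FrameLE
  simp only [component_sub_swap _ p q] at *
  rcases le_or_gt 0 (component β (q - p)) with h1 | h1 <;>
    rcases le_or_gt 0 (component (β + Real.pi / 2) (q - p)) with h2 | h2
  · exact Or.inl ⟨h1, h2⟩
  -- A zero coordinate still gives comparability; otherwise `p - q` is strictly negative along both
  -- normals, against `hp` or `hq` according to the sign `σ`.
  · rcases h1.eq_or_lt with h0 | h0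
    · exact Or.inr ⟨by linarith, by linarith⟩
    · have := k2 (by linarith) (by linarith)
      rcases hσ with rfl | rfl <;> linarith
  · rcases h2.eq_or_lt with h0 | h0
    · exact Or.inr ⟨by linarith, by linarith⟩
    · have := k1 (by linarith) (by linarith)
      rcases hσ with rfl | rfl <;> linarith
  · exact Or.inr ⟨by linarith, by linarith⟩

/-! ### From increasing walks to angle-monotone paths -/

/-- The bisector of the first quadrant of the frame of angle `β`. -/
noncomputable def bisector (β : ℝ) : Plane :=
  !₂[Real.cos β - Real.sin β, Real.sin β + Real.cos β]

theorem norm_bisector (β : ℝ) : ‖bisector β‖ = √2 := by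
  rw [EuclideanSpace.norm_eq, Fin.sum_univ_two]
  congr 1
  simp only [bisector, PiLp.toLp_apply, Real.norm_eq_abs, sq_abs, Matrix.cons_val_zero,
    Matrix.cons_val_one, Matrix.cons_val_fin_one]
  linear_combination 2 * Real.sin_sq_add_cos_sq β

theorem bisector_ne_zero (β : ℝ) : bisector β ≠ 0 := by
  rw [← norm_pos_iff, norm_bisector]
  positivity

/-- With frame coordinates `x, y ≥ 0`, the inner product with the bisector is `x + y ≥ √(x² + y²)`,
so the cosine is at least `1/√2`. Distinctness matters: the angle with the zero vector is `π/2` by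
convention. -/
theorem FrameLE.sub_mem_wedge {β : ℝ} {p q : Plane} (h : FrameLE β p q) (hpq : p ≠ q) :
    q - p ∈ wedge (bisector β) (Real.pi / 2) := by
  obtain ⟨h1, h2⟩ := h
  have hv : 0 < ‖q - p‖ := norm_pos_iff.2 (sub_ne_zero.2 hpq.symm)
  generalize q - p = v at *
  have hinner : inner ℝ (bisector β) v = component β v + component (β + Real.pi / 2) v := by
    rw [component_add_pi_div_two]
    simp [bisector, component, PiLp.inner_apply, Fin.sum_univ_two]
    ring
  have hnorm : ‖v‖ ^ 2 = component β v ^ 2 + component (β + Real.pi / 2) v ^ 2 := by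
    rw [component_add_pi_div_two, EuclideanSpace.norm_sq_eq, Fin.sum_univ_two]
    simp only [Real.norm_eq_abs, sq_abs, component]
    linear_combination (-(v 0) ^ 2 - (v 1) ^ 2) * Real.sin_sq_add_cos_sq β
  have hle : ‖v‖ ≤ component β v + component (β + Real.pi / 2) v := by
    apply abs_le_of_sq_le_sq' _ (add_nonneg h1 h2) |>.2
    nlinarith [mul_nonneg h1 h2]
  change InnerProductGeometry.angle _ _ ≤ _
  rw [InnerProductGeometry.angle, norm_bisector, hinner,
    show Real.pi / 2 / 2 = Real.arccos (√2 / 2) by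
      rw [← Real.cos_pi_div_four, Real.arccos_cos] <;> linarith [Real.pi_pos]]
  apply Real.arccos_le_arccos
  rw [le_div_iff₀ (by positivity)]
  calc √2 / 2 * (√2 * ‖v‖) = (√2 * √2) / 2 * ‖v‖ := by ring
    _ = ‖v‖ := by rw [Real.mul_self_sqrt (by norm_num)]; ring
    _ ≤ _ := hle

/-- The vertices `a` and `b` are joined by an angle-monotone path of width `90°`. -/
def SimpleGraph.AngleMonotoneConn {S : Finset Plane} (G : SimpleGraph S) (a b : S) : Prop :=
  ∃ p : G.Walk a b, IsAngleMonotonePath (Real.pi / 2) p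

namespace SimpleGraph.AngleMonotoneConn

variable {S : Finset Plane} {G H : SimpleGraph S} {a b : S}

theorem mono (hGH : G ≤ H) (h : G.AngleMonotoneConn a b) : H.AngleMonotoneConn a b := by
  obtain ⟨p, hp, u, hu, hd⟩ := h
  refine ⟨p.mapLe hGH, hp.mapLe hGH, u, hu, fun d hd' => ?_⟩
  rw [SimpleGraph.Walk.mapLe, SimpleGraph.Walk.darts_map, List.mem_map] at hd'
  obtain ⟨e, he, rfl⟩ := hd'
  exact hd e he

theorem symm (h : G.AngleMonotoneConn a b) : G.AngleMonotoneConn b a := by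
  obtain ⟨p, hp, u, hu, hd⟩ := h
  refine ⟨p.reverse, hp.reverse, -u, neg_ne_zero.2 hu, fun d hd' => ?_⟩
  have := hd _ (SimpleGraph.Walk.mem_darts_reverse.1 hd')
  change InnerProductGeometry.angle _ _ ≤ _
  rw [← neg_sub, InnerProductGeometry.angle_neg_neg]
  exact this

theorem refl (G : SimpleGraph S) (a : S) : G.AngleMonotoneConn a a :=
  ⟨SimpleGraph.Walk.nil, by simp, bisector 0, bisector_ne_zero 0, by simp⟩

theorem of_frameLE {β : ℝ}
    (h : ∃ p : G.Walk a b, ∀ d ∈ p.darts, FrameLE β d.fst d.snd) : G.AngleMonotoneConn a b := by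
  classical
  obtain ⟨p, hp⟩ := h
  refine ⟨p.bypass, p.bypass_isPath, bisector β, bisector_ne_zero β, fun d hd => ?_⟩
  exact (hp d (p.darts_bypass_subset_darts hd)).sub_mem_wedge
    fun h => d.adj.ne (Subtype.ext h)

end SimpleGraph.AngleMonotoneConn

/-! ### Divide and conquer over the labels -/

section Construction

variable {S : Finset Plane} {κ : Type*} [Fintype κ] (col : S → κ)

theorem SimpleGraph.ncard_edgeSet_sup_le {V : Type*} [Finite V] {G H : SimpleGraph V} {m n : ℕ}
    (hG : G.edgeSet.ncard ≤ m) (hH : H.edgeSet.ncard ≤ n) : (G ⊔ H).edgeSet.ncard ≤ m + n := by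
  rw [SimpleGraph.edgeSet_sup]
  exact (Set.ncard_union_le _ _).trans (add_le_add hG hH)

/-- All comparable pairs with one point in a union of chains, one for each colour, can be joined
by angle-monotone paths at the cost of two edges per point and colour. -/
theorem exists_graph_of_frame_chains (β : ℝ) (X I : Finset S) (hI : I ⊆ X)
    (hchain : ∀ p ∈ I, ∀ q ∈ I, col p = col q → FrameLE β p q ∨ FrameLE β q p) :
    ∃ G : SimpleGraph S, G.edgeSet.ncard ≤ 2 * (X.card * Fintype.card κ) ∧
      ∀ p ∈ X, ∀ q ∈ I, FrameLE β p q ∨ FrameLE β q p → G.AngleMonotoneConn p q := by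
  obtain ⟨G, hG, hG'⟩ := SimpleGraph.exists_graph_of_chains
    (fun p q : S => FrameLE β p q) (fun p => FrameLE.refl β p) (fun _ _ _ => FrameLE.trans)
    (fun _ _ h h' => Subtype.ext (h.antisymm h')) col X I hI hchain
  -- Turning by `π` reverses the order, which provides the decreasing walks.
  obtain ⟨H, hH, hH'⟩ := SimpleGraph.exists_graph_of_chains
    (fun p q : S => FrameLE (β + Real.pi) p q) (fun p => FrameLE.refl _ p)
    (fun _ _ _ => FrameLE.trans) (fun _ _ h h' => Subtype.ext (h.antisymm h')) col X I hI
    (fun p hp q hq h => by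
      rw [frameLE_add_pi, frameLE_add_pi]
      exact (hchain p hp q hq h).symm)
  refine ⟨G ⊔ H, ?_, fun p hp q hq h => ?_⟩
  · rw [two_mul]
    exact SimpleGraph.ncard_edgeSet_sup_le hG hH
  · rcases h with h | h
    · exact (SimpleGraph.AngleMonotoneConn.of_frameLE (hG' p hp q hq h)).mono le_sup_left
    · exact (SimpleGraph.AngleMonotoneConn.of_frameLE
        (hH' p hp q hq (frameLE_add_pi.2 h))).mono le_sup_right

variable (φ : S → ℝ)

/-- The points of each colour form a chain in every frame whose first axis closes a quadrant of
angles containing their labels `φ`. -/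
def IsChainLabelling : Prop :=
  ∀ (β : ℝ) (p q : S), col p = col q → φ p ∈ Set.Icc (β - Real.pi / 2) β →
    φ q ∈ Set.Icc (β - Real.pi / 2) β → FrameLE β p q ∨ FrameLE β q p

variable {col φ}

/-- Joins all pairs whose labels are separated by `β`: every pair is comparable in the frame of
angle `β` or in the one of angle `β + 90°`, and the labels below, respectively above, `β` make
chains for these frames. -/
theorem IsChainLabelling.exists_graph_of_split (hφ : IsChainLabelling col φ) (β : ℝ)
    (X X₁ X₂ : Finset S) (h₁ : X₁ ⊆ X) (h₂ : X₂ ⊆ X)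
    (hl₁ : ∀ p ∈ X₁, φ p ∈ Set.Icc (β - Real.pi / 2) β)
    (hl₂ : ∀ p ∈ X₂, φ p ∈ Set.Icc β (β + Real.pi / 2)) :
    ∃ G : SimpleGraph S, G.edgeSet.ncard ≤ 4 * (X.card * Fintype.card κ) ∧
      ∀ p ∈ X₁, ∀ q ∈ X₂, G.AngleMonotoneConn p q := by
  have hl₂' : ∀ p ∈ X₂, φ p ∈ Set.Icc (β + Real.pi / 2 - Real.pi / 2) (β + Real.pi / 2) := by
    simpa using hl₂
  obtain ⟨G, hG, hG'⟩ := exists_graph_of_frame_chains col β X X₁ h₁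
    fun p hp q hq h => hφ β p q h (hl₁ p hp) (hl₁ q hq)
  obtain ⟨H, hH, hH'⟩ := exists_graph_of_frame_chains col (β + Real.pi / 2) X X₂ h₂
    fun p hp q hq h => hφ _ p q h (hl₂' p hp) (hl₂' q hq)
  refine ⟨G ⊔ H, (SimpleGraph.ncard_edgeSet_sup_le hG hH).trans (by omega),
    fun p hp q hq => ?_⟩
  rcases frameLE_total β p q with h | h
  · exact ((hG' q (h₂ hq) p hp h.symm).symm).mono le_sup_left
  · exact (hH' p (h₁ hp) q hq h).mono le_sup_right

/-- Prescribing a cardinality instead of a threshold keeps the halves balanced when labels coincide.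
-/
theorem Finset.exists_lower_subset_card {α : Type*} [DecidableEq α] (f : α → ℝ) (X : Finset α)
    (m : ℕ) (hm : m ≤ X.card) :
    ∃ Y ⊆ X, Y.card = m ∧ ∀ x ∈ Y, ∀ y ∈ X \ Y, f x ≤ f y := by
  induction m with
  | zero => exact ⟨∅, by simp⟩
  | succ m ih =>
    obtain ⟨Y, hYX, hY, hle⟩ := ih (by omega)
    have hne : (X \ Y).Nonempty := by
      rw [← Finset.card_pos, Finset.card_sdiff_of_subset hYX]
      omega
    obtain ⟨a, ha, hmin⟩ := Finset.exists_min_image (X \ Y) f hne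
    have ha' := Finset.mem_sdiff.1 ha
    refine ⟨insert a Y, Finset.insert_subset ha'.1 hYX, ?_, fun x hx y hy => ?_⟩
    · rw [Finset.card_insert_of_notMem ha'.2, hY]
    · simp only [Finset.mem_sdiff, Finset.mem_insert, not_or] at hy
      rcases Finset.mem_insert.1 hx with rfl | hx
      · exact hmin y (Finset.mem_sdiff.2 ⟨hy.1, hy.2.2⟩)
      · exact hle x hx y (Finset.mem_sdiff.2 ⟨hy.1, hy.2.2⟩)

/-- Divide and conquer over the labels, for points whose labels lie in one quadrant. -/
theorem IsChainLabelling.exists_graph_of_quadrant (hφ : IsChainLabelling col φ) (a : ℝ) (h : ℕ)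
    (X : Finset S) (hX : X.card ≤ 2 ^ h) (ha : ∀ p ∈ X, φ p ∈ Set.Icc a (a + Real.pi / 2)) :
    ∃ G : SimpleGraph S, G.edgeSet.ncard ≤ 4 * h * (X.card * Fintype.card κ) ∧
      ∀ p ∈ X, ∀ q ∈ X, G.AngleMonotoneConn p q := by
  classical
  induction h generalizing X with
  | zero =>
    refine ⟨⊥, by simp, fun p hp q hq => ?_⟩
    obtain rfl := Finset.card_le_one.1 hX p hp q hq
    exact SimpleGraph.AngleMonotoneConn.refl _ _
  | succ h ih =>
    by_cases hc : X.card ≤ 2 ^ h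
    · obtain ⟨G, hG, hG'⟩ := ih X hc ha
      exact ⟨G, hG.trans (by gcongr; omega), hG'⟩
    obtain ⟨Y, hYX, hY, hle⟩ := Finset.exists_lower_subset_card φ X (2 ^ h) (by omega)
    have hYne : Y.Nonempty := by
      rw [← Finset.card_pos, hY]
      positivity
    obtain ⟨b, hb, hmax⟩ := Finset.exists_max_image Y φ hYne
    have hcard := Finset.card_sdiff_add_card_eq_card hYX
    obtain ⟨G₁, hG₁, hG₁'⟩ := ih Y hY.le fun p hp => ha p (hYX hp)
    obtain ⟨G₂, hG₂, hG₂'⟩ := ih (X \ Y) (by rw [pow_succ] at hX; omega)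
      fun p hp => ha p (Finset.sdiff_subset hp)
    -- The largest label of the lower half separates the halves; since all labels lie in one
    -- quadrant, both halves are within `π/2` of it.
    obtain ⟨H, hH, hH'⟩ := hφ.exists_graph_of_split (φ b) X Y (X \ Y) hYX Finset.sdiff_subset
      (fun p hp => ⟨by linarith [(ha b (hYX hb)).2, (ha p (hYX hp)).1], hmax p hp⟩)
      (fun p hp => ⟨hle b hb p hp,
        by linarith [(ha b (hYX hb)).1, (ha p (Finset.sdiff_subset hp)).2]⟩)
    refine ⟨G₁ ⊔ G₂ ⊔ H, (SimpleGraph.ncard_edgeSet_sup_le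
      (SimpleGraph.ncard_edgeSet_sup_le hG₁ hG₂) hH).trans ?_, fun p hp q hq => ?_⟩
    · rw [← hcard]
      apply le_of_eq
      ring
    · by_cases hpY : p ∈ Y <;> by_cases hqY : q ∈ Y
      · exact (hG₁' p hpY q hqY).mono (le_sup_left.trans le_sup_left)
      · exact (hH' p hpY q (Finset.mem_sdiff.2 ⟨hq, hqY⟩)).mono le_sup_right
      · exact (hH' q hqY p (Finset.mem_sdiff.2 ⟨hp, hpY⟩)).symm.mono le_sup_right
      · exact (hG₂' p (Finset.mem_sdiff.2 ⟨hp, hpY⟩) q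
          (Finset.mem_sdiff.2 ⟨hq, hqY⟩)).mono (le_sup_right.trans le_sup_left)

/-- The labels fill two quadrants; one further split at `π/2` joins these, hence `h + 1`. -/
theorem IsChainLabelling.exists_angleMonotoneGraph (hφ : IsChainLabelling col φ) (h : ℕ)
    (hS : S.card ≤ 2 ^ h) (hpi : ∀ p, φ p ∈ Set.Icc 0 Real.pi) :
    ∃ G : SimpleGraph S, G.edgeSet.ncard ≤ 4 * (h + 1) * (S.card * Fintype.card κ) ∧
      IsAngleMonotoneGraph (Real.pi / 2) G := by
  classical
  have huniv : (Finset.univ : Finset S).card = S.card := by simp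
  set Y : Finset S := Finset.univ.filter fun p => φ p ≤ Real.pi / 2 with hYdef
  have hY : ∀ p, p ∈ Y ↔ φ p ≤ Real.pi / 2 := by simp [hYdef]
  have hcard := Finset.card_sdiff_add_card_eq_card (Finset.subset_univ Y)
  rw [huniv] at hcard
  obtain ⟨G₁, hG₁, hG₁'⟩ := hφ.exists_graph_of_quadrant 0 h Y (by omega)
    fun p hp => ⟨(hpi p).1, by simpa using (hY p).1 hp⟩
  have hY₂ : ∀ p ∈ Finset.univ \ Y, φ p ∈ Set.Icc (Real.pi / 2) (Real.pi / 2 + Real.pi / 2) :=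
    fun p hp => by
      rw [Finset.mem_sdiff, hY, not_le] at hp
      exact ⟨hp.2.le, by linarith [(hpi p).2]⟩
  obtain ⟨G₂, hG₂, hG₂'⟩ := hφ.exists_graph_of_quadrant _ h (Finset.univ \ Y) (by omega) hY₂
  obtain ⟨H, hH, hH'⟩ := hφ.exists_graph_of_split (Real.pi / 2) Finset.univ Y _
    (Finset.subset_univ _) (Finset.subset_univ _)
    (fun p hp => ⟨by linarith [(hpi p).1], (hY p).1 hp⟩) hY₂
  rw [huniv] at hH
  refine ⟨G₁ ⊔ G₂ ⊔ H, (SimpleGraph.ncard_edgeSet_sup_le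
    (SimpleGraph.ncard_edgeSet_sup_le hG₁ hG₂) hH).trans ?_, fun p q => ?_⟩
  · rw [← hcard]
    apply le_of_eq
    ring
  · change SimpleGraph.AngleMonotoneConn _ p q
    by_cases hpY : p ∈ Y <;> by_cases hqY : q ∈ Y
    · exact (hG₁' p hpY q hqY).mono (le_sup_left.trans le_sup_left)
    · exact (hH' p hpY q (by simp [hqY])).mono le_sup_right
    · exact (hH' q hqY p (by simp [hpY])).symm.mono le_sup_right
    · exact (hG₂' p (by simp [hpY]) q (by simp [hqY])).mono (le_sup_right.trans le_sup_left)

end Construction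

/-! ### Outer normals of the layers -/

/-- A point of a finite set on the boundary of its convex hull has a supporting functional. -/
theorem exists_supporting_functional {Y : Finset Plane} {p : Plane} (hp : p ∈ Y)
    (hfr : p ∉ interior (convexHull ℝ (Y : Set Plane))) :
    ∃ f : Plane →ₗ[ℝ] ℝ, f ≠ 0 ∧ ∀ x ∈ Y, f x ≤ f p := by
  by_cases hint : (interior (convexHull ℝ (Y : Set Plane))).Nonempty
  · obtain ⟨f, hf, hle⟩ :=
      geometric_hahn_banach_of_nonempty_interior_point (convex_convexHull ℝ _) hfr hint
    refine ⟨f, fun h => hf ?_, fun x hx => hle x (subset_convexHull ℝ _ hx)⟩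
    ext v
    exact LinearMap.congr_fun h v
  -- A flat set lies on a line or is a point, so some nonzero functional is constant on it.
  · rw [interior_convexHull_nonempty_iff_affineSpan_eq_top,
      ← AffineSubspace.direction_eq_top_iff_of_nonempty
        ((affineSpan_nonempty ℝ).2 ⟨p, hp⟩)] at hint
    obtain ⟨f, hf, hle⟩ := Submodule.exists_le_ker_of_lt_top _ (lt_top_iff_ne_top.2 hint)
    refine ⟨f, hf, fun x hx => le_of_eq ?_⟩
    have := hle (AffineSubspace.vsub_mem_direction (subset_affineSpan ℝ _ hx)
      (subset_affineSpan ℝ _ hp))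
    rw [LinearMap.mem_ker, vsub_eq_sub, map_sub, sub_eq_zero] at this
    exact this

/-- A nonzero functional on the plane is a nonzero multiple of the component in some direction
of the upper half-plane. -/
theorem exists_component_of_functional (f : Plane →ₗ[ℝ] ℝ) (hf : f ≠ 0) :
    ∃ φ ∈ Set.Icc 0 Real.pi, ∃ b : Bool, ∀ v, f v ≤ 0 →
      (if b then (1 : ℝ) else -1) * component φ v ≤ 0 := by
  set z : ℂ := ⟨f (EuclideanSpace.single 0 1), f (EuclideanSpace.single 1 1)⟩ with hz
  have hfz : ∀ v, f v = z.re * v 0 + z.im * v 1 := by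
    intro v
    have hv : v = v 0 • EuclideanSpace.single 0 (1 : ℝ) + v 1 • EuclideanSpace.single 1 (1 : ℝ) := by
      ext i
      fin_cases i <;> simp
    conv_lhs => rw [hv]
    simp [hz, mul_comm]
  have hz0 : z ≠ 0 := by
    rintro h
    apply hf
    ext v
    rw [hfz, h]
    simp
  have hpos : 0 < ‖z‖ := norm_pos_iff.2 hz0
  have hcomp : ∀ v, f v = ‖z‖ * component z.arg v := by
    intro v
    rw [hfz, component, mul_add, ← mul_assoc, ← mul_assoc, Complex.norm_mul_cos_arg,
      Complex.norm_mul_sin_arg]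
  have hneg : ∀ v, f v ≤ 0 → component z.arg v ≤ 0 := by
    intro v hv
    rw [hcomp] at hv
    exact nonpos_of_mul_nonpos_right hv hpos
  rcases le_or_gt 0 z.arg with h | h
  · exact ⟨z.arg, ⟨h, Complex.arg_le_pi z⟩, true, fun v hv => by simpa using hneg v hv⟩
  -- A negative argument is turned by `π` into the upper half-plane, at the price of a sign.
  · refine ⟨z.arg + Real.pi, ⟨by linarith [Complex.neg_pi_lt_arg z], by linarith⟩, false,
      fun v hv => ?_⟩
    rw [component_add_pi]
    simpa using hneg v hv

/-- Points are labelled by outer normals of their layers (up to sign) and coloured by the layer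
and the sign. -/
theorem HasNestedConvexHulls.exists_isChainLabelling {t : ℕ} {S : Finset Plane}
    (h : HasNestedConvexHulls S t) :
    ∃ (col : S → Fin t × Bool) (φ : S → ℝ), IsChainLabelling col φ ∧
      ∀ p, φ p ∈ Set.Icc 0 Real.pi := by
  classical
  have hlayer : ∀ p : S, ∃ i : Fin t, (p : Plane) ∈ peel^[i] S ∧ (p : Plane) ∉ peel^[i + 1] S := by
    intro p
    by_contra! hcon
    have hmem : ∀ i ≤ t, (p : Plane) ∈ peel^[i] S := by
      intro i
      induction i with
      | zero => exact fun _ => p.2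
      | succ i ih => exact fun hi => hcon ⟨i, hi⟩ (ih (by omega))
    have := hmem t le_rfl
    rw [h.1] at this
    simp at this
  choose i hi hi' using hlayer
  have hnormal : ∀ p : S, ∃ φ ∈ Set.Icc 0 Real.pi, ∃ b : Bool, ∀ x ∈ peel^[i p] S,
      (if b then (1 : ℝ) else -1) * component φ (x - p) ≤ 0 := by
    intro p
    obtain ⟨f, hf, hle⟩ := exists_supporting_functional (hi p) fun hint => by
      refine hi' p ?_
      rw [Function.iterate_succ_apply', peel, Finset.mem_filter]
      exact ⟨hi p, fun hfr => hfr.2 hint⟩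
    obtain ⟨φ, hφ, b, hb⟩ := exists_component_of_functional f hf
    exact ⟨φ, hφ, b, fun x hx => hb _ (by rw [map_sub]; linarith [hle x hx])⟩
  choose φ hφ b hb using hnormal
  refine ⟨fun p => (i p, b p), φ, fun β p q hpq hp hq => ?_, hφ⟩
  obtain ⟨hipq, hbpq⟩ := Prod.mk.inj hpq
  have h1 := hb p q (by rw [hipq]; exact hi q)
  have h2 := hb q p (by rw [← hipq]; exact hi p)
  rw [← hbpq] at h2
  exact frameLE_or_frameLE_of_normals (by split_ifs <;> simp) hp hq h1 h2

theorem mainTheorem4 :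
    ∃ C : ℝ, 0 < C ∧ ∀ (t : ℕ) (S : Finset Plane), HasNestedConvexHulls S t →
      ∃ G : SimpleGraph S, IsAngleMonotoneGraph (Real.pi / 2) G ∧
        (G.edgeSet.ncard : ℝ) ≤ C * (t : ℝ) ^ 2 * (S.card : ℝ) * Real.log (S.card : ℝ) := by
  have hlog2 : 0 < Real.log 2 := Real.log_pos one_lt_two
  refine ⟨24 / Real.log 2, by positivity, fun t S hS => ?_⟩
  rcases Nat.lt_or_ge S.card 2 with hcard | hcard
  -- For `n ≤ 1` the logarithm is `0` (with `Real.log 0 = 0`), so no edge is allowed and none is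
  -- needed.
  · refine ⟨⊥, fun a b => ?_, ?_⟩
    · obtain rfl : a = b := Subtype.ext (Finset.card_le_one.1 (by omega) _ a.2 _ b.2)
      exact SimpleGraph.AngleMonotoneConn.refl _ _
    · have : 0 ≤ Real.log (S.card : ℝ) := Real.log_natCast_nonneg _
      simp only [SimpleGraph.edgeSet_bot, Set.ncard_empty, Nat.cast_zero]
      positivity
  obtain ⟨col, φ, hφ, hpi⟩ := hS.exists_isChainLabelling
  obtain ⟨G, hG, hG'⟩ := hφ.exists_angleMonotoneGraph (Nat.log 2 S.card + 1)
    (Nat.lt_pow_succ_log_self one_lt_two _).le hpi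
  refine ⟨G, hG', ?_⟩
  have hlog : (Nat.log 2 S.card : ℝ) * Real.log 2 ≤ Real.log S.card := by
    rw [← Real.log_pow]
    apply Real.log_le_log (by positivity)
    exact_mod_cast Nat.pow_log_le_self 2 (by omega)
  have hlog' : Real.log 2 ≤ Real.log S.card :=
    Real.log_le_log two_pos (by exact_mod_cast hcard)
  -- Of the summand `2`, one unit rounds the depth up and one pays for the split at `π/2`; both are
  -- absorbed because `n ≥ 2`. The constant is `24 = 4 · 3 · 2`, the last factor counting signs.
  have hdepth : (Nat.log 2 S.card : ℝ) + 2 ≤ 3 * Real.log S.card / Real.log 2 := by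
    rw [le_div_iff₀ hlog2]
    linarith
  have ht : (t : ℝ) ≤ (t : ℝ) ^ 2 := by exact_mod_cast Nat.le_self_pow two_ne_zero t
  calc (G.edgeSet.ncard : ℝ)
      ≤ 4 * ((Nat.log 2 S.card : ℝ) + 2) * (S.card * (t * 2)) := by
        rw [Fintype.card_prod, Fintype.card_fin, Fintype.card_bool] at hG
        exact_mod_cast hG
    _ ≤ 4 * (3 * Real.log S.card / Real.log 2) * (S.card * ((t : ℝ) ^ 2 * 2)) := by
        gcongr
    _ = 24 / Real.log 2 * (t : ℝ) ^ 2 * S.card * Real.log S.card := by ring
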